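/- Let $N=\{1,\dots,n\}$ be a finite set of agents and $G$ a finite set of goods. Each agent $i$ has a valuation $v_i:2^G\to\mathbb{R}$ that is a matroid rank function: $v_i(\emptyset)=0$; the marginal gain $\Delta_i(S,g)=v_i(S\cup\{g\})-v_i(S)$ is $0$ or $1$ for all $S\subseteq G$, $g\in G$; and $\Delta_i(S,g)\ge\Delta_i(T,g)$ whenever $S\subseteq T\subseteq G$, $g\in G$. An allocation is a partition $X=(X_0,X_1,\dots,X_n)$ of $G$ into possibly empty bundles; $X_0$ holds the unallocated goods, and $v_0(S)=|S|$. The exchange graph of $X$ has an edge from $g\in X_k$ ($0\le k\le n$) to another good $g'\neq g$ if $v_k((X_k\setminus\{g\})\cup\{g'\})=v_k(X_k)$. Let $F_i(X)=\{g\in G:\Delta_i(X_i,g)=1\}$. A vector $x\in\mathbb{R}^b$ lexicographically dominates $y\in\mathbb{R}^b$ if there is a $k$ with $x_j=y_j$ for all $j<k$ and $x_k>y_k$. Each agent $i$ has a share $c_i\ge 0$. Let $M>0$ be greater than $v_i(S)/c_i$ for all $i$ with $c_i>0$ and all $S\subseteq G$. The fair-share gain function is $$\phi(X,i)=\begin{cases}\left(-\frac{v_i(X_i)}{c_i},\,-c_i\right)&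 c_i>0,\\ (-M,\,0)& c_i=0,\end{cases}$$ with values compared lexicographically. General Yankee Swap with gain function $\phi$ starts with $X=(G,\emptyset,\dots,\emptyset)$ and $U=N$. While $U\ne\emptyset$, it takes the agent $i$ of least index among the maximizers of $\phi(X,\cdot)$ over $U$ and looks for a shortest path $(g_1,\dots,g_t)$, $t\ge1$, in the exchange graph of $X$ from $F_i(X)$ to $X_0$. If there is one, then $g_1$ is given to $i$ and each $g_{j+1}$ ($1\le j<t$) is given to the agent who held $g_j$ before this iteration; any shortest path may be used. If there is no such path, $i$ is removed from $U$. When $U=\emptyset$, it returns $X$. For an allocation $Y$, let $\vec\mu(Y)$ be the vector of the values $v_i(Y_i)/c_i$ over all agents $i$ with $c_i>0$, sorted in increasing order. Theorem. With the fair-share gain function, General Yankee Swap always terminates and returns an allocation (there is no infinite execution, and an iteration can be carried out whenever $U\neq\emptyset$). For every allocation $X$ that it can return, whatever shortest paths are chosen, there is no allocation $Y$ such that $\vec\mu(Y)$ lexicographically dominates $\vec\mu(X)$. -/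

import Mathlib

namespace FairShare

/-- Matroid rank functions (binary submodular valuations) on subsets of `G`. -/
structure IsMRF {G : Type*} [DecidableEq G] (f : Finset G → ℝ) : Prop where
  empty : f ∅ = 0
  marginal : ∀ (S : Finset G) (g : G), f (insert g S) - f S = 0 ∨ f (insert g S) - f S = 1
  submodular : ∀ (S T : Finset G) (g : G), S ⊆ T →
    f (insert g T) - f T ≤ f (insert g S) - f S

/-- An allocation of the goods `G` to the agents `Fin n`, i.e. a partition
`(X_0, X_1, …, X_n)` of `G` into possibly empty bundles, given by the map that sends each good to
its owner. The owner `none` is the dummy agent `0`, who holds the unallocated goods. -/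
abbrev Allocation (n : ℕ) (G : Type*) := G → Option (Fin n)

/-- The bundle of the agent `k`; `bundle X none` is the set of unallocated goods. -/
def bundle {n : ℕ} {G : Type*} [Fintype G] (X : Allocation n G) (k : Option (Fin n)) : Finset G :=
  Finset.univ.filter (fun g => X g = k)

/-- The utility vector `(v_1(X_1), …, v_n(X_n))`. -/
def utility {n : ℕ} {G : Type*} [Fintype G] (v : Fin n → Finset G → ℝ) (X : Allocation n G) :
    Fin n → ℝ :=
  fun i => v i (bundle X (some i))

/-- The valuations, extended to the dummy agent, who values a bundle by its cardinality. -/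
def extVal {n : ℕ} {G : Type*} (v : Fin n → Finset G → ℝ) : Option (Fin n) → Finset G → ℝ
  | none => fun S => (S.card : ℝ)
  | some i => v i

/-- The edges of the exchange graph: the owner `k` of `g` is indifferent to replacing `g` by
another good `g'`. -/
def Edge {n : ℕ} {G : Type*} [Fintype G] [DecidableEq G] (v : Fin n → Finset G → ℝ)
    (X : Allocation n G) (g g' : G) : Prop :=
  g ≠ g' ∧ extVal v (X g) (insert g' ((bundle X (X g)).erase g)) = extVal v (X g) (bundle X (X g))

/-- The set `F_i(X)` of the goods which give agent `i` a marginal gain of `1`. -/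
def desired {n : ℕ} {G : Type*} [Fintype G] [DecidableEq G] (v : Fin n → Finset G → ℝ)
    (X : Allocation n G) (i : Fin n) : Set G :=
  {g | v i (insert g (bundle X (some i))) - v i (bundle X (some i)) = 1}

/-- `P = (g_1, …, g_t)`, `t ≥ 1`, is a path in the exchange graph from `F_i(X)` to the set of the
unallocated goods. -/
def IsPath {n : ℕ} {G : Type*} [Fintype G] [DecidableEq G] (v : Fin n → Finset G → ℝ)
    (X : Allocation n G) (i : Fin n) (P : List G) : Prop :=
  (∃ g ∈ P.head?, g ∈ desired v X i) ∧ (∃ g ∈ P.getLast?, X g = none) ∧ P.IsChain (Edge v X)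

/-- A path from `F_i(X)` to the unallocated goods of least length. -/
def IsShortestPath {n : ℕ} {G : Type*} [Fintype G] [DecidableEq G] (v : Fin n → Finset G → ℝ)
    (X : Allocation n G) (i : Fin n) (P : List G) : Prop :=
  IsPath v X i P ∧ ∀ Q : List G, IsPath v X i Q → P.length ≤ Q.length

/-- Transfer of goods along a path `(g_1, …, g_t)`: `g_1` is given to `k`, and each `g_{j+1}` is
given to the agent who owns `g_j` under `X`. All other goods keep their owner. -/
def transfer {n : ℕ} {G : Type*} [DecidableEq G] (X : Allocation n G) :
    Option (Fin n) → List G → Allocation n G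
  | _, [] => X
  | k, g :: P => Function.update (transfer X (X g) P) g k

/-- Lexicographic domination: `x` exceeds `y` at the first coordinate where they differ. -/
def LexDominates {b : ℕ} (x y : Fin b → ℝ) : Prop :=
  ∃ k, (∀ j, j < k → x j = y j) ∧ y k < x k

/-- The agents in `U` at which the gain function `φ` is lexicographically maximal, given the
utility vector `x`. -/
def argmax {n b : ℕ} (φ : (Fin n → ℝ) → Fin n → Fin b → ℝ) (x : Fin n → ℝ)
    (U : Finset (Fin n)) : Set (Fin n) :=
  {k | k ∈ U ∧ ∀ j ∈ U, ¬ LexDominates (φ x j) (φ x k)}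

/-- A state of General Yankee Swap: the current allocation and the set of agents still playing. -/
structure State (n : ℕ) (G : Type*) where
  alloc : Allocation n G
  playing : Finset (Fin n)

/-- At the start no good is allocated and all agents are playing. -/
def initState (n : ℕ) (G : Type*) : State n G := ⟨fun _ => none, Finset.univ⟩

/-- One iteration of the loop of General Yankee Swap with gain function `φ`. The agent `i` of
least index among the maximizers of `φ` is chosen. If there is a path from `F_i(X)` to the
unallocated goods, goods are transferred along a shortest one (any of them may be used) and its
first good is given to `i`; otherwise `i` stops playing. -/
inductive Step {n b : ℕ} {G : Type*} [Fintype G] [DecidableEq G] (v : Fin n → Finset G → ℝ)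
    (φ : (Fin n → ℝ) → Fin n → Fin b → ℝ) : State n G → State n G → Prop
  | augment (X : Allocation n G) (U : Finset (Fin n)) (i : Fin n) (P : List G)
      (hi : IsLeast (argmax φ (utility v X) U) i) (hP : IsShortestPath v X i P) :
      Step v φ ⟨X, U⟩ ⟨transfer X (some i) P, U⟩
  | remove (X : Allocation n G) (U : Finset (Fin n)) (i : Fin n)
      (hi : IsLeast (argmax φ (utility v X) U) i) (hP : ∀ P : List G, ¬ IsPath v X i P) :
      Step v φ ⟨X, U⟩ ⟨X, U.erase i⟩

/-- `X` is returned by some execution of General Yankee Swap with gain function `φ`: the loop,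
started at the initial state, reaches a state with allocation `X` and no agent playing. -/
def IsOutput {n b : ℕ} {G : Type*} [Fintype G] [DecidableEq G] (v : Fin n → Finset G → ℝ)
    (φ : (Fin n → ℝ) → Fin n → Fin b → ℝ) (X : Allocation n G) : Prop :=
  Relation.ReflTransGen (Step v φ) (initState n G) ⟨X, ∅⟩

/-- The fair-share gain function: `(-x_i / c_i, -c_i)` if `c_i > 0`, and `(-M, 0)` if `c_i = 0`. -/
noncomputable def fairShareGain {n : ℕ} (c : Fin n → ℝ) (M : ℝ) (x : Fin n → ℝ) (i : Fin n) :
    Fin 2 → ℝ :=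
  if 0 < c i then ![-(x i / c i), -(c i)] else ![-M, 0]

/-- The agents with a positive share. -/
noncomputable def posAgents {n : ℕ} (c : Fin n → ℝ) : Finset (Fin n) :=
  Finset.univ.filter (fun i => 0 < c i)

/-- The values `v_i(Y_i) / c_i` of the agents with `c_i > 0`, listed by increasing index. -/
noncomputable def shareFractions {n : ℕ} {G : Type*} [Fintype G] (v : Fin n → Finset G → ℝ)
    (c : Fin n → ℝ) (Y : Allocation n G) : Fin (posAgents c).card → ℝ :=
  fun j => utility v Y ((posAgents c).orderEmbOfFin rfl j) / c ((posAgents c).orderEmbOfFin rfl j)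

/-- The sorted fair-share normalized utility vector: the values `v_i(Y_i) / c_i` of the agents with
`c_i > 0`, sorted in increasing order. -/
noncomputable def sortedShareFractions {n : ℕ} {G : Type*} [Fintype G]
    (v : Fin n → Finset G → ℝ) (c : Fin n → ℝ) (Y : Allocation n G) :
    Fin (posAgents c).card → ℝ :=
  shareFractions v c Y ∘ Tuple.sort (shareFractions v c Y)

end FairShare

/-! Augmenting along a shortest path raises the chosen agent's utility by one, leaves every other
utility unchanged and keeps all bundles independent (`IsChordless.transfer`). If agent i has no
path, the goods reachable from `F_i(X)` certify, as in the min-max formula for matroid union, that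
some set of agents containing i already has the greatest possible joint utility (`exists_tight`).
Such tight sets are closed under union, and no later augmentation can serve a member of one. Hence
`Invariant` persists: at the end each agent i lies in a tight set in which the last unit of every
agent with nonzero utility had at least the priority of one more unit for i.

For optimality, the lexicographic order is replaced by the sum of exp(-s r) over the share fractions
r: for large s, a dominating vector has the smaller sum. This sum telescopes into unit gains
`expGain`, and for large s the priorities given by the gain function become inequalities between
these gains. For every threshold, the output has at least as many units with gain above it as any
other allocation, by tightness. So its total gain is greatest (`Invariant.sum_expGain_le`) and its
sum of exponentials least, which excludes domination. -/

namespace FairShare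

/-! ### Matroid rank functions: independence and closure -/

namespace IsMRF

variable {G : Type*} [DecidableEq G] {f : Finset G → ℝ}

theorem le_insert (hf : IsMRF f) (S : Finset G) (g : G) : f S ≤ f (insert g S) := by
  rcases hf.marginal S g with h | h <;> linarith

theorem insert_le (hf : IsMRF f) (S : Finset G) (g : G) : f (insert g S) ≤ f S + 1 := by
  rcases hf.marginal S g with h | h <;> linarith

theorem le_union (hf : IsMRF f) (S T : Finset G) : f S ≤ f (T ∪ S) := by
  induction T using Finset.induction_on with
  | empty => simp
  | insert a T _ ih => rw [Finset.insert_union]; exact ih.trans (hf.le_insert _ _)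

theorem mono (hf : IsMRF f) {S T : Finset G} (h : S ⊆ T) : f S ≤ f T := by
  have := hf.le_union S T
  rwa [Finset.union_eq_left.2 h] at this

theorem union_add_le (hf : IsMRF f) {S T : Finset G} (h : S ⊆ T) (D : Finset G) :
    f (D ∪ T) + f S ≤ f (D ∪ S) + f T := by
  induction D using Finset.induction_on with
  | empty => simp [add_comm]
  | insert a D _ ih =>
    have := hf.submodular (D ∪ S) (D ∪ T) a (Finset.union_subset_union_right h)
    simp only [Finset.insert_union]
    linarith

theorem union_add_inter_le (hf : IsMRF f) (S T : Finset G) :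
    f (S ∪ T) + f (S ∩ T) ≤ f S + f T := by
  have := hf.union_add_le (Finset.inter_subset_right (s₁ := S) (s₂ := T)) S
  rwa [Finset.union_eq_left.2 Finset.inter_subset_left] at this

theorem nonneg (hf : IsMRF f) (S : Finset G) : 0 ≤ f S := by
  rw [← hf.empty]; exact hf.mono (Finset.empty_subset S)

theorem union_le_add_card (hf : IsMRF f) (S T : Finset G) : f (T ∪ S) ≤ f S + T.card := by
  induction T using Finset.induction_on with
  | empty => simp
  | insert a T ha ih =>
    rw [Finset.insert_union, Finset.card_insert_of_notMem ha]
    push_cast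
    linarith [hf.insert_le (T ∪ S) a]

theorem le_card (hf : IsMRF f) (S : Finset G) : f S ≤ S.card := by
  simpa [hf.empty] using hf.union_le_add_card ∅ S

theorem exists_nat (hf : IsMRF f) (S : Finset G) : ∃ m : ℕ, f S = m := by
  induction S using Finset.induction_on with
  | empty => exact ⟨0, by simp [hf.empty]⟩
  | insert a S _ ih =>
    obtain ⟨m, hm⟩ := ih
    rcases hf.marginal S a with h | h
    · exact ⟨m, by linarith⟩
    · exact ⟨m + 1, by push_cast; linarith⟩

/-- Subsets of independent sets are independent. -/
theorem eq_card_of_subset (hf : IsMRF f) {S T : Finset G} (h : S ⊆ T) (hT : f T = T.card) :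
    f S = S.card := by
  have h1 := hf.union_le_add_card S (T \ S)
  rw [Finset.sdiff_union_of_subset h] at h1
  have h2 : ((T \ S).card : ℝ) + S.card = T.card := by
    exact_mod_cast Finset.card_sdiff_add_card_eq_card h
  linarith [hf.le_card S]

/-- Goods without marginal gain have no marginal gain jointly. -/
theorem union_eq_of_forall_insert_eq (hf : IsMRF f) {S : Finset G} (T : Finset G)
    (h : ∀ g ∈ T, f (insert g S) = f S) : f (T ∪ S) = f S := by
  induction T using Finset.induction_on with
  | empty => simp
  | insert a T ha ih =>
    have h1 := ih fun g hg => h g (Finset.mem_insert_of_mem hg)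
    have h2 := hf.submodular S (T ∪ S) a Finset.subset_union_right
    have h3 := h a (Finset.mem_insert_self a T)
    rw [Finset.insert_union]
    linarith [hf.le_insert (T ∪ S) a]

theorem insert_eq_of_subset (hf : IsMRF f) {S T : Finset G} (h : S ⊆ T) (hST : f T = f S)
    (g : G) : f (insert g T) = f (insert g S) := by
  have h1 := hf.submodular S T g h
  have h2 := hf.mono (Finset.insert_subset_insert g h)
  linarith

/-- Sets with the same closure have the same marginal gains. -/
theorem insert_eq_insert (hf : IsMRF f) {S T : Finset G} (hS : f (S ∪ T) = f S)
    (hT : f (S ∪ T) = f T) (g : G) : f (insert g S) = f (insert g T) := by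
  rw [← hf.insert_eq_of_subset Finset.subset_union_left hS,
    ← hf.insert_eq_of_subset Finset.subset_union_right hT]

end IsMRF

/-! ### Augmentation along shortest paths -/

@[simp]
theorem mem_bundle {n : ℕ} {G : Type*} [Fintype G] {X : Allocation n G} {g : G}
    {k : Option (Fin n)} : g ∈ bundle X k ↔ X g = k := by
  simp [bundle]

section Swap

variable {n : ℕ} {G : Type*} [DecidableEq G] {X : Allocation n G}

/-- Good `z` goes to the owner of `a`, who gives up `a`. -/
def swap (X : Allocation n G) (a z : G) : Allocation n G :=
  Function.update (Function.update X z (X a)) a none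

/-- This peels a path from its unallocated end: after one exchange `a` is the unallocated good that
ends the shorter path. It drives the induction in `IsChordless.transfer`. -/
theorem transfer_append_pair {a z : G} (k : Option (Fin n)) {Q : List G} (ha : a ∉ Q)
    (hz : z ∉ Q) : transfer X k (Q ++ [a, z]) = transfer (swap X a z) k (Q ++ [a]) := by
  induction Q generalizing k with
  | nil => simp [transfer, swap]
  | cons q Q ih =>
    simp only [List.mem_cons, not_or] at ha hz
    simp only [List.cons_append, transfer]
    rw [ih _ ha.2 hz.2]
    congr 2
    simp [swap, Function.update_of_ne (Ne.symm ha.1), Function.update_of_ne (Ne.symm hz.1)]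

theorem swap_of_ne {a z b : G} (ha : b ≠ a) (hz : b ≠ z) : swap X a z b = X b := by
  simp [swap, ha, hz]

end Swap

variable {n : ℕ} {G : Type*} [Fintype G] [DecidableEq G] {v : Fin n → Finset G → ℝ}
  {X : Allocation n G}

/-- No good is wasted: all bundles are independent. -/
def Clean (v : Fin n → Finset G → ℝ) (X : Allocation n G) : Prop :=
  ∀ i, v i (bundle X (some i)) = (bundle X (some i)).card

/-- A path without shortcuts, whose inner goods are allocated and not desired by `i`. -/
structure IsChordless (v : Fin n → Finset G → ℝ) (X : Allocation n G) (i : Fin n)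
    (P : List G) : Prop where
  isPath : IsPath v X i P
  notMem_desired : ∀ g T, P = g :: T → ∀ b ∈ T, b ∉ desired v X i
  allocated : ∀ A a m B, P = A ++ a :: m :: B → X a ≠ none
  no_shortcut : ∀ A a m B, P = A ++ a :: m :: B → ∀ b ∈ B, ¬ Edge v X a b

/-- Any violation would allow a shorter path by cutting out a piece. Chordlessness replaces minimal
length because it is easily seen to survive peeling. -/
theorem IsShortestPath.isChordless {i : Fin n} {P : List G} (h : IsShortestPath v X i P) :
    IsChordless v X i P := by
  obtain ⟨⟨⟨g₀, hg₀, hd⟩, ⟨g₁, hg₁, hn⟩, hch⟩, hmin⟩ := h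
  refine ⟨⟨⟨g₀, hg₀, hd⟩, ⟨g₁, hg₁, hn⟩, hch⟩, ?_, ?_, ?_⟩
  · rintro g T rfl b hb hbd
    obtain ⟨T₁, T₂, rfl⟩ := List.append_of_mem hb
    have := hmin (b :: T₂) ⟨⟨b, by simp, hbd⟩, ⟨g₁, ?_, hn⟩, ?_⟩
    · simp at this; omega
    · rw [← List.cons_append, List.getLast?_append] at hg₁
      simpa using hg₁
    · rw [← List.cons_append] at hch
      exact hch.right_of_append
  · rintro A a m B rfl ha
    have := hmin (A ++ [a]) ⟨⟨g₀, ?_, hd⟩, ⟨a, by simp, ha⟩, ?_⟩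
    · simp at this
    · cases A <;> simpa using hg₀
    · have : A ++ a :: m :: B = (A ++ [a]) ++ m :: B := by simp
      rw [this] at hch
      exact hch.left_of_append
  · rintro A a m B rfl b hb he
    obtain ⟨B₁, B₂, rfl⟩ := List.append_of_mem hb
    have := hmin (A ++ a :: b :: B₂) ⟨⟨g₀, ?_, hd⟩, ⟨g₁, ?_, hn⟩, ?_⟩
    · simp at this; omega
    · cases A <;> simpa using hg₀
    · have : A ++ a :: m :: (B₁ ++ b :: B₂) = (A ++ a :: m :: B₁) ++ b :: B₂ := by simp
      rw [this, List.getLast?_append] at hg₁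
      have : A ++ a :: b :: B₂ = (A ++ [a]) ++ b :: B₂ := by simp
      rw [this, List.getLast?_append]
      simp only [List.getLast?_cons_cons, List.getLast?_append] at hg₁ ⊢
      obtain ⟨w, hw⟩ : ∃ w, (b :: B₂).getLast? = some w :=
        ⟨_, List.getLast?_eq_some_getLast (by simp)⟩
      simpa [hw] using hg₁
    · have h1 : A ++ a :: m :: (B₁ ++ b :: B₂) = (A ++ a :: m :: B₁) ++ b :: B₂ := by simp
      have h2 : A ++ a :: m :: (B₁ ++ b :: B₂) = (A ++ [a]) ++ m :: (B₁ ++ b :: B₂) := by simp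
      have h3 : A ++ a :: b :: B₂ = (A ++ [a]) ++ b :: B₂ := by simp
      rw [h3, List.isChain_append]
      refine ⟨?_, ?_, by simpa using he⟩
      · rw [h2] at hch; exact hch.left_of_append
      · rw [h1] at hch; exact hch.right_of_append

theorem bundle_swap_self {a z : G} {k : Fin n} (ha : X a = some k) (hz : X z = none) :
    bundle (swap X a z) (some k) = insert z ((bundle X (some k)).erase a) := by
  have haz : a ≠ z := by rintro rfl; simp [ha] at hz
  ext g
  by_cases hga : g = a
  · subst hga; simp [swap, haz]
  · by_cases hgz : g = z
    · subst hgz; simp [swap, hga, ha]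
    · simp [swap, hga, hgz]

theorem bundle_swap_of_ne {a z : G} {k l : Fin n} (ha : X a = some k) (hz : X z = none)
    (hl : l ≠ k) : bundle (swap X a z) (some l) = bundle X (some l) := by
  have haz : a ≠ z := by rintro rfl; simp [ha] at hz
  ext g
  by_cases hga : g = a
  · subst hga; simp [swap, ha, Ne.symm hl]
  · by_cases hgz : g = z
    · subst hgz; simp [swap, hga, ha, hz, Ne.symm hl]
    · simp [swap, hga, hgz]

section Swap

variable {a z : G} {k : Fin n}

theorem swap_utility (ha : X a = some k) (hz : X z = none)
    (he : Edge v X a z) : utility v (swap X a z) = utility v X := by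
  funext l
  by_cases hl : l = k
  · subst hl
    simp only [utility, bundle_swap_self ha hz]
    simpa [Edge, ha, extVal] using he.2
  · simp only [utility, bundle_swap_of_ne ha hz hl]

theorem swap_card (ha : X a = some k) (hz : X z = none) (l : Fin n) :
    (bundle (swap X a z) (some l)).card = (bundle X (some l)).card := by
  by_cases hl : l = k
  · subst hl
    rw [bundle_swap_self ha hz, Finset.card_insert_of_notMem (by simp [hz]),
      Finset.card_erase_add_one (by simp [ha])]
  · rw [bundle_swap_of_ne ha hz hl]

theorem Clean.swap (hX : Clean v X) (ha : X a = some k) (hz : X z = none)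
    (he : Edge v X a z) : Clean v (swap X a z) := by
  intro l
  rw [swap_card ha hz]
  exact (congrFun (swap_utility ha hz he) l).trans (hX l)

/-- If `i` owns `a`, then `z` lies in the closure of the bundle of `i`, so exchanging `a` for `z`
preserves the closure and with it all marginal gains. -/
theorem desired_swap (hv : ∀ i, IsMRF (v i)) (ha : X a = some k)
    (hz : X z = none) (he : Edge v X a z) {i : Fin n} (hi : z ∉ desired v X i) :
    desired v (FairShare.swap X a z) i = desired v X i := by
  have hu : v i (bundle (FairShare.swap X a z) (some i)) = v i (bundle X (some i)) :=
    congrFun (swap_utility ha hz he) i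
  by_cases hl : i = k
  · subst hl
    have h1 : v i (insert z (bundle X (some i))) = v i (bundle X (some i)) := by
      rcases (hv i).marginal (bundle X (some i)) z with h | h
      · linarith
      · exact absurd h hi
    have h2 : bundle X (some i) ∪ bundle (FairShare.swap X a z) (some i) =
        insert z (bundle X (some i)) := by
      rw [bundle_swap_self ha hz, Finset.union_insert,
        Finset.union_eq_left.2 (Finset.erase_subset _ _)]
    ext g
    simp only [desired, Set.mem_ofPred_eq, hu]
    rw [← (hv i).insert_eq_insert (by rw [h2, h1]) (by rw [h2, h1, hu]) g]
  · simp only [desired, bundle_swap_of_ne ha hz hl]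

/-- Only the case where `q` and `a` share an owner matters. Without an edge from `q` to `z`, the
bundle minus `q` already spans `z`, so its closure is the same before and after the exchange. -/
theorem edge_swap_iff (hv : ∀ i, IsMRF (v i)) (hX : Clean v X) (ha : X a = some k)
    (hz : X z = none) (he : Edge v X a z) {q b : G} (hqa : q ≠ a) (hqz : q ≠ z)
    (hq : X q ≠ none) (hn : ¬ Edge v X q z) :
    Edge v (FairShare.swap X a z) q b ↔ Edge v X q b := by
  obtain ⟨l, hl⟩ := Option.ne_none_iff_exists'.1 hq
  have hu : v l (bundle (FairShare.swap X a z) (some l)) = v l (bundle X (some l)) :=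
    congrFun (swap_utility ha hz he) l
  simp only [Edge, swap_of_ne hqa hqz, hl, extVal, hu]
  by_cases hlk : l = k
  · subst hlk
    set I := bundle X (some l) with hI
    have hqI : q ∈ I := by simp [hI, hl]
    have hc : ((I.erase q).card : ℝ) + 1 = I.card := by
      exact_mod_cast Finset.card_erase_add_one hqI
    have h1 : v l (I.erase q) = (I.erase q).card :=
      (hv l).eq_card_of_subset (Finset.erase_subset _ _) (hX l)
    have h2 : v l (insert z (I.erase q)) = v l (I.erase q) := by
      rcases (hv l).marginal (I.erase q) z with h | h
      · linarith
      · refine absurd ⟨hqz, ?_⟩ hn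
        simp only [hl, extVal, ← hI]
        rw [hX l, ← hI]; linarith
    have hcl := hX.swap ha hz he l
    have h3 := (hv l).eq_card_of_subset
      (Finset.erase_subset q (bundle (FairShare.swap X a z) (some l))) hcl
    have h4 : ((((bundle (FairShare.swap X a z) (some l)).erase q).card : ℕ) : ℝ) + 1 =
        I.card := by
      rw [hI, ← swap_card ha hz l]
      exact_mod_cast Finset.card_erase_add_one (by simp [swap_of_ne hqa hqz, hl])
    have h5 : I.erase q ∪ (bundle (FairShare.swap X a z) (some l)).erase q =
        insert z (I.erase q) := by
      rw [bundle_swap_self ha hz, ← hI]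
      ext g
      by_cases hgq : g = q
      · subst hgq; simp [hqz]
      · simp only [Finset.mem_union, Finset.mem_erase, Finset.mem_insert]
        tauto
    rw [(hv l).insert_eq_insert (S := I.erase q)
      (T := (bundle (FairShare.swap X a z) (some l)).erase q)
      (by rw [h5, h2]) (by rw [h5, h2, h1, h3]; linarith)]
  · rw [bundle_swap_of_ne ha hz hlk]

end Swap

theorem IsChordless.swap {i : Fin n} {Q : List G} {a z : G} (hv : ∀ i, IsMRF (v i))
    (hX : Clean v X) (h : IsChordless v X i (Q ++ [a, z])) :
    a ∉ Q ∧ z ∉ Q ∧ (∃ k, X a = some k) ∧ X z = none ∧ Edge v X a z ∧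
      IsChordless v (swap X a z) i (Q ++ [a]) := by
  obtain ⟨⟨⟨g₀, hg₀, hd⟩, ⟨g₁, hg₁, hn⟩, hch⟩, hnd, hal, hns⟩ := h
  have hz : X z = none := by simp at hg₁; rwa [hg₁]
  have hqn : ∀ q ∈ Q, X q ≠ none ∧ ¬ Edge v X q z := by
    intro q hq
    obtain ⟨A, B, rfl⟩ := List.append_of_mem hq
    rcases B with _ | ⟨m, B⟩
    · exact ⟨hal A q a [z] (by simp), hns A q a [z] (by simp) z (by simp)⟩
    · exact ⟨hal A q m (B ++ [a, z]) (by simp), hns A q m (B ++ [a, z]) (by simp) z (by simp)⟩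
  have he : Edge v X a z := by
    have := hch.right_of_append
    simpa using this
  have haQ : a ∉ Q := fun ha => (hqn a ha).2 he
  have hzQ : z ∉ Q := fun hh => (hqn z hh).1 hz
  obtain ⟨k, ha⟩ := Option.ne_none_iff_exists'.1 (hal Q a z [] rfl)
  have hed : ∀ q ∈ Q, ∀ b, Edge v (FairShare.swap X a z) q b ↔ Edge v X q b := fun q hq b =>
    edge_swap_iff hv hX ha hz he (fun e => haQ (by rwa [← e])) (fun e => hzQ (by rwa [← e]))
      (hqn q hq).1 (hqn q hq).2
  have hdes : desired v (FairShare.swap X a z) i = desired v X i := by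
    refine desired_swap hv ha hz he ?_
    rcases Q with _ | ⟨q, Q⟩
    · exact hnd a [z] rfl z (by simp)
    · exact hnd q (Q ++ [a, z]) rfl z (by simp)
  -- A good with a successor is not the last one, hence it lies in `Q`, where edges are unaffected
  -- by the exchange.
  have hmemQ : ∀ A b m B, Q ++ [a] = A ++ b :: m :: B → b ∈ Q := by
    intro A b m B e
    have : (Q ++ [a]).dropLast = (A ++ b :: m :: B).dropLast := by rw [e]
    rw [List.dropLast_concat, List.dropLast_append_of_ne_nil (by simp)] at this
    rw [this]; simp
  have hext : ∀ A b m B, Q ++ [a] = A ++ b :: m :: B →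
      Q ++ [a, z] = A ++ b :: m :: (B ++ [z]) := by
    intro A b m B e
    have : Q ++ [a, z] = (Q ++ [a]) ++ [z] := by simp
    rw [this, e]; simp
  refine ⟨haQ, hzQ, ⟨k, ha⟩, hz, he, ⟨⟨g₀, ?_, hdes ▸ hd⟩, ⟨a, by simp, by simp [FairShare.swap]⟩,
    ?_⟩, ?_, ?_, ?_⟩
  · cases Q <;> simpa using hg₀
  · have h1 : Q ++ [a, z] = (Q ++ [a]) ++ [z] := by simp
    rw [h1] at hch
    have h2 := hch.left_of_append
    rw [List.isChain_iff_forall_rel_of_append_cons_cons] at h2 ⊢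
    intro x y l₁ l₂ e
    exact (hed x (hmemQ _ _ _ _ e) y).2 (h2 e)
  · intro g T e b hb
    rw [hdes]
    refine hnd g (T ++ [z]) ?_ b (by simp [hb])
    have : Q ++ [a, z] = (Q ++ [a]) ++ [z] := by simp
    rw [this, e]; simp
  · intro A b m B e
    have hbQ := hmemQ A b m B e
    rw [swap_of_ne (fun e => haQ (by rwa [← e])) (fun e => hzQ (by rwa [← e]))]
    exact (hqn b hbQ).1
  · intro A b m B e d hd
    rw [hed b (hmemQ A b m B e)]
    exact hns A b m (B ++ [z]) (hext A b m B e) d (by simp [hd])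

theorem clean_assign {i : Fin n} {g : G} (hX : Clean v X) (hg : X g = none)
    (hd : g ∈ desired v X i) :
    Clean v (Function.update X g (some i)) ∧
      utility v (Function.update X g (some i)) =
        Function.update (utility v X) i (utility v X i + 1) := by
  have h1 : bundle (Function.update X g (some i)) (some i) = insert g (bundle X (some i)) := by
    ext b
    by_cases hb : b = g
    · subst hb; simp
    · simp [hb]
  have h2 : ∀ l ≠ i, bundle (Function.update X g (some i)) (some l) = bundle X (some l) := by
    intro l hl
    ext b
    by_cases hb : b = g
    · subst hb; simp [hg, Ne.symm hl]
    · simp [hb]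
  have h3 : v i (insert g (bundle X (some i))) = v i (bundle X (some i)) + 1 := by
    have := hd
    simp only [desired, Set.mem_ofPred_eq] at this
    linarith
  constructor
  · intro l
    by_cases hl : l = i
    · subst hl
      rw [h1, h3, hX l, Finset.card_insert_of_notMem (by simp [hg])]
      push_cast; rfl
    · rw [h2 l hl, hX l]
  · funext l
    by_cases hl : l = i
    · subst hl
      simp [utility, h1, h3]
    · simp [utility, h2 l hl, hl]

theorem IsChordless.transfer {i : Fin n} {P : List G} (hv : ∀ i, IsMRF (v i))
    (hX : Clean v X) (h : IsChordless v X i P) :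
    Clean v (transfer X (some i) P) ∧
      utility v (transfer X (some i) P) =
        Function.update (utility v X) i (utility v X i + 1) := by
  obtain ⟨t, ht⟩ : ∃ t, P.length = t := ⟨_, rfl⟩
  induction t generalizing P X with
  | zero =>
    obtain ⟨⟨⟨g₀, hg₀, -⟩, -⟩, -⟩ := h
    simp [List.length_eq_zero_iff.1 ht] at hg₀
  | succ t ih =>
    rcases List.eq_nil_or_concat' P with rfl | ⟨P', z, rfl⟩
    · simp at ht
    rcases List.eq_nil_or_concat' P' with rfl | ⟨Q, a, rfl⟩
    · obtain ⟨⟨⟨g₀, hg₀, hd⟩, ⟨g₁, hg₁, hn⟩, -⟩, -⟩ := h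
      simp only [List.nil_append, List.head?_cons, Option.mem_def, Option.some.injEq,
        List.getLast?_singleton] at hg₀ hg₁
      subst hg₀ hg₁
      simpa [FairShare.transfer] using clean_assign hX hn hd
    · have e : Q ++ [a] ++ [z] = Q ++ [a, z] := by simp
      rw [e] at h ht ⊢
      obtain ⟨haQ, hzQ, ⟨k, ha⟩, hz, he, hc⟩ := h.swap hv hX
      rw [transfer_append_pair _ haQ hzQ, ← swap_utility ha hz he]
      exact ih (hX.swap ha hz he) hc (by simp at ht ⊢; omega)

/-! ### Tight sets of agents and their certificates -/

/-- Weak duality for matroid union: each good outside `T` adds at most one unit to one agent, and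
the goods inside `T` add at most `v k T` to agent `k`. -/
theorem sum_utility_le (hv : ∀ i, IsMRF (v i)) (Y : Allocation n G) (A : Finset (Fin n))
    (T : Finset G) : ∑ k ∈ A, utility v Y k ≤ Tᶜ.card + ∑ k ∈ A, v k T := by
  have h1 : ∀ k, utility v Y k ≤ (bundle Y (some k) \ T).card + v k T := by
    intro k
    have h := (hv k).union_le_add_card T (bundle Y (some k) \ T)
    have h' := (hv k).mono (S := bundle Y (some k)) (T := bundle Y (some k) \ T ∪ T) (by simp)
    simp only [utility]
    linarith
  have h2 : ∑ k ∈ A, (bundle Y (some k) \ T).card ≤ Tᶜ.card := by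
    rw [← Finset.card_biUnion]
    · refine Finset.card_le_card fun g hg => ?_
      simp only [Finset.mem_biUnion, Finset.mem_sdiff] at hg
      obtain ⟨k, -, -, h⟩ := hg
      simpa using h
    · intro k _ l _ hkl
      rw [Function.onFun, Finset.disjoint_left]
      intro g hg hg'
      simp only [Finset.mem_sdiff, mem_bundle] at hg hg'
      exact hkl (Option.some.inj (hg.1.symm.trans hg'.1))
  calc ∑ k ∈ A, utility v Y k ≤ ∑ k ∈ A, (((bundle Y (some k) \ T).card : ℝ) + v k T) :=
        Finset.sum_le_sum fun k _ => h1 k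
    _ ≤ _ := by
        rw [Finset.sum_add_distrib]
        gcongr
        exact_mod_cast h2

/-- The agents in `A` jointly have the greatest possible utility `∑ k ∈ A, x k`, as is witnessed
by a set `T` of goods. -/
def Tight (v : Fin n → Finset G → ℝ) (x : Fin n → ℝ) (A : Finset (Fin n)) : Prop :=
  ∃ T : Finset G, (Tᶜ.card : ℝ) + ∑ k ∈ A, v k T ≤ ∑ k ∈ A, x k

theorem Tight.sum_utility_le (hv : ∀ i, IsMRF (v i)) {x : Fin n → ℝ} {A : Finset (Fin n)}
    (h : Tight v x A) (Y : Allocation n G) : ∑ k ∈ A, utility v Y k ≤ ∑ k ∈ A, x k := by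
  obtain ⟨T, hT⟩ := h
  exact (FairShare.sum_utility_le hv Y A T).trans hT

theorem tight_empty (x : Fin n → ℝ) : Tight v x ∅ := ⟨Finset.univ, by simp⟩

/-- Uncrossing: `S ∩ T` certifies the union because weak duality for `A ∩ B` with the set `S ∪ T`
bounds the other half of the submodular inequality. -/
theorem Tight.union (hv : ∀ i, IsMRF (v i)) {A B : Finset (Fin n)}
    (hA : Tight v (utility v X) A) (hB : Tight v (utility v X) B) :
    Tight v (utility v X) (A ∪ B) := by
  obtain ⟨S, hS⟩ := hA
  obtain ⟨T, hT⟩ := hB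
  refine ⟨S ∩ T, ?_⟩
  have h1 := FairShare.sum_utility_le hv X (A ∩ B) (S ∪ T)
  have h2 : (((S ∩ T)ᶜ.card : ℝ)) + (S ∪ T)ᶜ.card = Sᶜ.card + Tᶜ.card := by
    rw [Finset.compl_inter, Finset.compl_union]
    exact_mod_cast Finset.card_union_add_card_inter _ _
  have h3 : ∀ u : Fin n → ℝ, ∑ k ∈ A ∪ B, u k + ∑ k ∈ A ∩ B, u k = ∑ k ∈ A, u k + ∑ k ∈ B, u k :=
    fun u => Finset.sum_union_inter
  have h4 : ∑ k ∈ A ∪ B, v k (S ∩ T) + ∑ k ∈ A ∩ B, v k (S ∪ T) ≤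
      ∑ k ∈ A, v k S + ∑ k ∈ B, v k T := by
    have e1 : ∀ (C : Finset (Fin n)) (u : Fin n → ℝ),
        ∑ k ∈ C, u k = ∑ k, if k ∈ C then u k else 0 := fun C u => by
      simp [Finset.sum_ite_mem]
    rw [e1 (A ∪ B), e1 (A ∩ B), e1 A, e1 B, ← Finset.sum_add_distrib, ← Finset.sum_add_distrib]
    refine Finset.sum_le_sum fun k _ => ?_
    have h5 := (hv k).union_add_inter_le S T
    have h6 := (hv k).mono (Finset.inter_subset_left (s₁ := S) (s₂ := T))
    have h7 := (hv k).mono (Finset.inter_subset_right (s₁ := S) (s₂ := T))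
    by_cases ha : k ∈ A <;> by_cases hb : k ∈ B <;> simp [ha, hb] <;> linarith
  linarith [h3 (utility v X)]

theorem Tight.biUnion (hv : ∀ i, IsMRF (v i)) {ι : Type*} [DecidableEq ι] (S : Finset ι)
    {A : ι → Finset (Fin n)} (h : ∀ i ∈ S, Tight v (utility v X) (A i)) :
    Tight v (utility v X) (S.biUnion A) := by
  induction S using Finset.induction_on with
  | empty => exact tight_empty _
  | insert i S _ ih =>
    rw [Finset.biUnion_insert]
    exact (h i (by simp)).union hv (ih fun j hj => h j (Finset.mem_insert_of_mem hj))

/-- If no good of `D` can be exchanged for `t`, then `t` depends on the goods outside of `D`. -/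
theorem IsMRF.insert_sdiff_eq {f : Finset G → ℝ} (hf : IsMRF f) {I D : Finset G} {t : G}
    (hI : f I = I.card) (ht : f (insert t I) = f I) (hDI : D ⊆ I)
    (hD : ∀ g ∈ D, f (insert t (I.erase g)) ≠ f I) :
    f (insert t (I \ D)) = f (I \ D) := by
  induction D using Finset.induction_on with
  | empty => simpa using ht
  | insert a D haD ih =>
    have haI : a ∈ I := hDI (by simp)
    have ih := ih ((Finset.subset_insert a D).trans hDI)
      fun g hg => hD g (Finset.mem_insert_of_mem hg)
    have c1 : ((I.erase a).card : ℝ) + 1 = I.card := by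
      exact_mod_cast Finset.card_erase_add_one haI
    have c2 : (((I \ D).erase a).card : ℝ) + 1 = (I \ D).card := by
      exact_mod_cast Finset.card_erase_add_one (by simp [haI, haD])
    have e1 := hf.eq_card_of_subset (Finset.erase_subset a I) hI
    have e2 := hf.eq_card_of_subset (Finset.sdiff_subset (s := I) (t := D)) hI
    have e3 := hf.eq_card_of_subset
      ((Finset.erase_subset a (I \ D)).trans Finset.sdiff_subset) hI
    have h1 : f (insert t (I.erase a)) = f (I.erase a) := by
      rcases hf.marginal (I.erase a) t with h | h
      · linarith
      · exact absurd (by linarith) (hD a (by simp))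
    have h2 := hf.union_add_inter_le (insert t (I \ D)) (insert t (I.erase a))
    have h3 : insert t (I \ D) ∪ insert t (I.erase a) = insert t I := by
      ext g
      by_cases hg : g = a
      · subst hg; simp [haI, haD]
      · simp only [Finset.mem_union, Finset.mem_insert, Finset.mem_sdiff, Finset.mem_erase]
        tauto
    have h4 : insert t ((I \ D).erase a) ⊆ insert t (I \ D) ∩ insert t (I.erase a) := by
      intro g
      simp only [Finset.mem_inter, Finset.mem_insert, Finset.mem_sdiff, Finset.mem_erase]
      tauto
    have h5 : I \ insert a D = (I \ D).erase a := by
      ext g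
      simp only [Finset.mem_insert, Finset.mem_sdiff, Finset.mem_erase]
      tauto
    rw [h5]
    have h6 := hf.mono h4
    have h7 := hf.le_insert ((I \ D).erase a) t
    rw [h3] at h2
    linarith

/-- If no unallocated good can be reached from the goods desired by `i`, then `i` belongs to a
tight set of agents. -/
theorem exists_tight (hv : ∀ i, IsMRF (v i)) (hX : Clean v X) {i : Fin n}
    (hP : ∀ P : List G, ¬ IsPath v X i P) : ∃ A, i ∈ A ∧ Tight v (utility v X) A := by
  classical
  set R : Finset G :=
    Finset.univ.filter fun g => ∃ h ∈ desired v X i, Relation.ReflTransGen (Edge v X) h g with hR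
  have hmem : ∀ g, g ∈ R ↔ ∃ h ∈ desired v X i, Relation.ReflTransGen (Edge v X) h g := by
    simp [hR]
  have hal : ∀ g ∈ R, X g ≠ none := by
    intro g hg hn
    obtain ⟨h, hh, hgr⟩ := (hmem g).1 hg
    obtain ⟨l, hl, hlast⟩ := List.exists_isChain_cons_of_relationReflTransGen hgr
    exact hP (h :: l) ⟨⟨h, by simp, hh⟩,
      ⟨g, by rw [List.getLast?_eq_some_getLast (by simp), hlast]; rfl, hn⟩, hl⟩
  have hclosed : ∀ g ∈ R, ∀ t, Edge v X g t → t ∈ R := by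
    intro g hg t ht
    obtain ⟨h, hh, hgr⟩ := (hmem g).1 hg
    exact (hmem t).2 ⟨h, hh, hgr.tail ht⟩
  set A : Finset (Fin n) := Finset.univ.filter fun k => k = i ∨ ∃ g ∈ R, X g = some k with hA
  -- A good `t` with positive marginal gain would be reachable: desired directly if `k` is `i`, and
  -- otherwise by an edge from a good of `R` that `k` owns.
  have hdep : ∀ k ∈ A, ∀ t ∉ R, v k (insert t (bundle X (some k))) = v k (bundle X (some k)) := by
    intro k hk t ht
    simp only [hA, Finset.mem_filter, Finset.mem_univ, true_and] at hk
    rcases hk with rfl | ⟨g, hg, hgk⟩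
    · rcases (hv k).marginal (bundle X (some k)) t with h | h
      · linarith
      · exact absurd ((hmem t).2 ⟨t, h, .refl⟩) ht
    · rcases (hv k).marginal (bundle X (some k)) t with h | h
      · linarith
      · refine absurd (hclosed g hg t ⟨fun e => ht (e ▸ hg), ?_⟩) ht
        simp only [hgk, extVal]
        have h1 := (hv k).submodular ((bundle X (some k)).erase g) (bundle X (some k)) t
          (Finset.erase_subset _ _)
        have h2 := (hv k).eq_card_of_subset (Finset.erase_subset g (bundle X (some k))) (hX k)
        have h3 : (((bundle X (some k)).erase g).card : ℝ) + 1 = (bundle X (some k)).card := by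
          exact_mod_cast Finset.card_erase_add_one (by simp [hgk])
        have h4 := (hv k).insert_le ((bundle X (some k)).erase g) t
        linarith [hX k]
  -- No edge leaves `R`, so each good outside `R` depends on the part of the bundle outside `R`;
  -- that part is thus a basis of the complement of `R`.
  have hrank : ∀ k ∈ A, v k Rᶜ = (bundle X (some k) \ R).card := by
    intro k hk
    have h0 := (hv k).eq_card_of_subset
      (Finset.sdiff_subset (s := bundle X (some k)) (t := R)) (hX k)
    rw [← h0]
    have h1 := (hv k).union_eq_of_forall_insert_eq (S := bundle X (some k) \ R) Rᶜ ?_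
    · rwa [Finset.union_eq_left.2] at h1
      intro g hg
      simp only [Finset.mem_sdiff] at hg
      simpa using hg.2
    · intro t ht
      rw [Finset.mem_compl] at ht
      rw [← Finset.sdiff_inter_self_left]
      refine (hv k).insert_sdiff_eq (hX k) (hdep k hk t ht) Finset.inter_subset_left ?_
      intro g hg h
      simp only [Finset.mem_inter, mem_bundle] at hg
      exact ht (hclosed g hg.2 t ⟨fun e => ht (e ▸ hg.2), by simpa [hg.1, extVal] using h⟩)
  refine ⟨A, by simp [hA], Rᶜ, ?_⟩
  rw [compl_compl, Finset.sum_congr rfl hrank]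
  have h1 : R.card ≤ ∑ k ∈ A, (bundle X (some k) ∩ R).card := by
    refine le_trans (Finset.card_le_card fun g hg => ?_) Finset.card_biUnion_le
    obtain ⟨k, hk⟩ := Option.ne_none_iff_exists'.1 (hal g hg)
    simp only [Finset.mem_biUnion, Finset.mem_inter, mem_bundle]
    refine ⟨k, ?_, hk, hg⟩
    simp only [hA, Finset.mem_filter, Finset.mem_univ, true_and]
    exact Or.inr ⟨g, hg, hk⟩
  have h2 : ∀ k, utility v X k =
      ((bundle X (some k) ∩ R).card : ℝ) + (bundle X (some k) \ R).card := by
    intro k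
    rw [utility, hX k]
    exact_mod_cast (Finset.card_inter_add_card_sdiff _ _).symm
  rw [Finset.sum_congr rfl fun k _ => h2 k, Finset.sum_add_distrib]
  gcongr
  exact_mod_cast h1

end FairShare

/-! ### The gain function as a linear order -/

namespace FairShare

theorem lexDominates_iff (p q : Fin 2 → ℝ) :
    LexDominates p q ↔ toLex (q 0, q 1) < toLex (p 0, p 1) := by
  rw [Prod.Lex.toLex_lt_toLex]
  constructor
  · rintro ⟨k, h, hk⟩
    fin_cases k
    · exact Or.inl hk
    · exact Or.inr ⟨(h 0 (by simp)).symm, hk⟩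
  · rintro (h | ⟨h, hk⟩)
    · exact ⟨0, fun j hj => absurd hj (Fin.not_lt_zero j), h⟩
    · refine ⟨1, fun j hj => ?_, hk⟩
      obtain rfl : j = 0 := by omega
      exact h.symm

section Key

variable {n : ℕ} (c : Fin n → ℝ) (M : ℝ)

/-- The fair-share gain of agent `i` at utility `m`, in the lexicographic order. -/
noncomputable def key (m : ℝ) (i : Fin n) : ℝ ×ₗ ℝ :=
  toLex (fairShareGain c M (fun _ => m) i 0, fairShareGain c M (fun _ => m) i 1)

theorem mem_argmax_iff (x : Fin n → ℝ) (U : Finset (Fin n)) (k : Fin n) :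
    k ∈ argmax (fairShareGain c M) x U ↔ k ∈ U ∧ ∀ j ∈ U, key c M (x j) j ≤ key c M (x k) k := by
  have (j : Fin n) : ¬ LexDominates (fairShareGain c M x j) (fairShareGain c M x k) ↔
      key c M (x j) j ≤ key c M (x k) k := by
    rw [lexDominates_iff, not_lt]
    rfl
  simp [argmax, this]

theorem key_antitone (i : Fin n) : Antitone fun m => key c M m i := by
  intro m m' h
  simp only [key, fairShareGain]
  split_ifs with hi
  · rw [Prod.Lex.toLex_le_toLex]
    rcases h.lt_or_eq with h | rfl
    · left
      simpa using div_lt_div_of_pos_right h hi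
    · right; simp
  · rfl

variable {c M}

/-- Here the size of `M` matters: an agent with zero share has first coordinate `-M`, below that of
`i`, so it cannot precede `i`. -/
theorem of_key_le_key {i k : Fin n} {m p : ℝ} (hi : 0 < c i) (hm : m / c i < M)
    (h : key c M m i ≤ key c M p k) :
    0 < c k ∧ (p / c k < m / c i ∨ p / c k = m / c i ∧ c k ≤ c i) := by
  rw [key, key, Prod.Lex.toLex_le_toLex] at h
  by_cases hk : 0 < c k
  · refine ⟨hk, ?_⟩
    simp only [fairShareGain, hi, hk, if_true, Matrix.cons_val_zero, Matrix.cons_val_one,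
      neg_lt_neg_iff, neg_inj, neg_le_neg_iff] at h
    tauto
  · simp only [fairShareGain, hi, hk, if_true, if_false, Matrix.cons_val_zero] at h
    rcases h with h | ⟨h, -⟩ <;> linarith

theorem exists_isLeast_argmax (x : Fin n → ℝ) {U : Finset (Fin n)} (hU : U ≠ ∅) :
    ∃ i, IsLeast (argmax (fairShareGain c M) x U) i := by
  have hne : (argmax (fairShareGain c M) x U).Nonempty := by
    obtain ⟨k, hk, h⟩ := U.exists_max_image (fun j => key c M (x j) j)
      (Finset.nonempty_iff_ne_empty.2 hU)
    exact ⟨k, (mem_argmax_iff c M x U k).2 ⟨hk, h⟩⟩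
  obtain ⟨i, hi, h⟩ := (Set.toFinite (argmax (fairShareGain c M) x U)).exists_minimal hne
  exact ⟨i, hi, fun j hj => (le_total i j).elim id fun hji => h hj hji⟩

end Key

/-! ### The invariant and termination -/

theorem Clean.card_unallocated {n : ℕ} {G : Type*} [Fintype G] {v : Fin n → Finset G → ℝ}
    {X : Allocation n G} (hX : Clean v X) :
    ((bundle X none).card : ℝ) + ∑ i, utility v X i = Fintype.card G := by
  have h := Finset.card_eq_sum_card_fiberwise (f := X) (s := Finset.univ) (t := Finset.univ)
    (fun _ _ => by simp)
  rw [Fintype.sum_option] at h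
  simp only [utility]
  rw [Finset.sum_congr rfl fun i _ => hX i, ← Finset.card_univ, h]
  push_cast
  rfl

section Run

variable {n : ℕ} {G : Type*} [Fintype G] [DecidableEq G] {v : Fin n → Finset G → ℝ}
  {c : Fin n → ℝ} {M : ℝ}

theorem exists_step (s : State n G) (hs : s.playing ≠ ∅) :
    ∃ s', Step v (fairShareGain c M) s s' := by
  classical
  obtain ⟨X, U⟩ := s
  obtain ⟨i, hi⟩ := exists_isLeast_argmax (c := c) (M := M) (utility v X) hs
  by_cases h : ∃ t, ∃ P, IsPath v X i P ∧ P.length = t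
  · obtain ⟨P, hP, hl⟩ := Nat.find_spec h
    exact ⟨_, .augment X U i P hi ⟨hP, fun Q hQ => hl ▸ Nat.find_min' h ⟨Q, hQ, rfl⟩⟩⟩
  · exact ⟨_, .remove X U i hi fun P hP => h ⟨_, P, hP, rfl⟩⟩

/-- The invariant of General Yankee Swap: no good is wasted, every unit of utility was gained with
priority over what the playing agents may still gain, and every other agent belongs to a tight set
in which every unit of utility had priority over a further gain of that agent. -/
structure Invariant (v : Fin n → Finset G → ℝ) (c : Fin n → ℝ) (M : ℝ) (s : State n G) :
    Prop where
  clean : Clean v s.alloc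
  priority : ∀ k, utility v s.alloc k = 0 ∨ ∀ j ∈ s.playing,
    key c M (utility v s.alloc j) j ≤ key c M (utility v s.alloc k - 1) k
  removed : ∀ i ∉ s.playing, ∃ A, i ∈ A ∧ Tight v (utility v s.alloc) A ∧
    ∀ k ∈ A, utility v s.alloc k = 0 ∨
      key c M (utility v s.alloc i) i ≤ key c M (utility v s.alloc k - 1) k

theorem invariant_initState (hv : ∀ i, IsMRF (v i)) : Invariant v c M (initState n G) := by
  have h (i : Fin n) : bundle (fun _ : G => (none : Option (Fin n))) (some i) = ∅ := by
    ext; simp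
  refine ⟨fun i => ?_, fun k => .inl ?_, fun i hi => absurd (Finset.mem_univ i) hi⟩
  · simp [initState, h, (hv i).empty]
  · simp [initState, utility, h, (hv k).empty]

/-- Keys only fall as utilities grow, so old priorities persist, and the new unit had priority
because `i` was a maximizer. On removal, the priorities that hold against the playing agent `i` are
frozen on its tight set. -/
theorem Invariant.step (hv : ∀ i, IsMRF (v i)) {s s' : State n G} (h : Invariant v c M s)
    (hs : Step v (fairShareGain c M) s s') : Invariant v c M s' := by
  obtain ⟨hc, hp, hr⟩ := h
  rcases hs with ⟨X, U, i, P, hi, hP⟩ | ⟨X, U, i, hi, hP⟩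
  · obtain ⟨hiU, hmax⟩ := (mem_argmax_iff c M _ _ _).1 hi.1
    obtain ⟨hc', hu⟩ := hP.isChordless.transfer hv hc
    simp only at hc hp hr
    have hle : ∀ j, utility v X j ≤ utility v (transfer X (some i) P) j := by
      intro j
      rw [hu]
      by_cases hj : j = i
      · subst hj; simp
      · simp [hj]
    refine ⟨hc', fun k => ?_, fun l hl => ?_⟩
    · simp only
      by_cases hk : k = i
      · subst hk
        right
        intro j hj
        refine (key_antitone c M j (hle j)).trans ((hmax j hj).trans_eq ?_)
        simp [hu]
      · have hk' : utility v (transfer X (some i) P) k = utility v X k := by simp [hu, hk]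
        rw [hk']
        exact (hp k).imp id fun h j hj => (key_antitone c M j (hle j)).trans (h j hj)
    · obtain ⟨A, hlA, hA, hAk⟩ := hr l hl
      -- An augmentation serving a member of `A` would push its joint utility beyond the maximum, so
      -- utilities within old tight sets never change.
      have hiA : i ∉ A := by
        intro hiA
        refine (hA.sum_utility_le hv (transfer X (some i) P)).not_gt ?_
        exact Finset.sum_lt_sum (fun j _ => hle j) ⟨i, hiA, by simp [hu]⟩
      have heq : ∀ k ∈ A, utility v (transfer X (some i) P) k = utility v X k := by
        intro k hk
        have : k ≠ i := fun e => hiA (e ▸ hk)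
        simp [hu, this]
      refine ⟨A, hlA, ?_, fun k hk => ?_⟩
      · obtain ⟨T, hT⟩ := hA
        exact ⟨T, by rwa [Finset.sum_congr rfl heq]⟩
      · simp only
        rw [heq k hk, heq l hlA]
        exact hAk k hk
  · obtain ⟨hiU, hmax⟩ := (mem_argmax_iff c M _ _ _).1 hi.1
    simp only at hc hp hr
    refine ⟨hc, fun k => (hp k).imp id fun h j hj => h j (Finset.mem_of_mem_erase hj),
      fun l hl => ?_⟩
    by_cases hli : l = i
    · subst hli
      obtain ⟨A, hlA, hA⟩ := exists_tight hv hc hP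
      exact ⟨A, hlA, hA, fun k _ => (hp k).imp id fun h => h l hiU⟩
    · exact hr l fun h => hl (Finset.mem_erase.2 ⟨hli, h⟩)

/-- With independent bundles, total utility counts allocated goods, so an augmentation uses up
unallocated goods; a removal shrinks the set of playing agents. -/
theorem Step.measure_lt (hv : ∀ i, IsMRF (v i)) {s s' : State n G} (h : Invariant v c M s)
    (hs : Step v (fairShareGain c M) s s') :
    (bundle s'.alloc none).card + s'.playing.card < (bundle s.alloc none).card + s.playing.card := by
  have h' := h.step hv hs
  rcases hs with ⟨X, U, i, P, hi, hP⟩ | ⟨X, U, i, hi, hP⟩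
  · have h1 := h.clean.card_unallocated
    have h2 := h'.clean.card_unallocated
    obtain ⟨-, hu⟩ := hP.isChordless.transfer hv h.clean
    simp only at h1 h2 hu ⊢
    have h3 : ∑ j, utility v X j < ∑ j, utility v (transfer X (some i) P) j := by
      refine Finset.sum_lt_sum (fun j _ => ?_) ⟨i, Finset.mem_univ i, by simp [hu]⟩
      rw [hu]
      by_cases hj : j = i
      · subst hj; simp
      · simp [hj]
    have h4 : (bundle (transfer X (some i) P) none).card < (bundle X none).card := by
      have : ((bundle (transfer X (some i) P) none).card : ℝ) < (bundle X none).card := by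
        linarith
      exact_mod_cast this
    omega
  · have := Finset.card_erase_lt_of_mem ((mem_argmax_iff c M _ _ _).1 hi.1).1
    simp only
    omega

theorem not_exists_infinite_run (hv : ∀ i, IsMRF (v i)) :
    ¬ ∃ s : ℕ → State n G, s 0 = initState n G ∧
      ∀ t, Step v (fairShareGain c M) (s t) (s (t + 1)) := by
  rintro ⟨s, h0, hs⟩
  have hinv : ∀ t, Invariant v c M (s t) := by
    intro t
    induction t with
    | zero => rw [h0]; exact invariant_initState hv
    | succ t ih => exact ih.step hv (hs t)
  have hdec : ∀ t, (bundle (s t).alloc none).card + (s t).playing.card + t ≤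
      (bundle (s 0).alloc none).card + (s 0).playing.card := by
    intro t
    induction t with
    | zero => simp
    | succ t ih =>
      have := (hs t).measure_lt hv (hinv t)
      omega
  have := hdec ((bundle (s 0).alloc none).card + (s 0).playing.card + 1)
  omega

theorem Invariant.of_reachable (hv : ∀ i, IsMRF (v i)) {s : State n G}
    (h : Relation.ReflTransGen (Step v (fairShareGain c M)) (initState n G) s) :
    Invariant v c M s := by
  induction h with
  | refl => exact invariant_initState hv
  | tail _ hs ih => exact ih.step hv hs

end Run

/-! ### Majorization and the exponential potential -/

section Sums

open Filter

/-- Majorization: if above every threshold `A` has at least as many values as `B`, then `A` has at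
least as great a sum. -/
theorem sum_le_sum_of_card_le {α : Type*} [DecidableEq α] {A B : Finset α} {g : α → ℝ}
    (hg : ∀ a ∈ A, 0 ≤ g a)
    (h : ∀ t, (B.filter (t ≤ g ·)).card ≤ (A.filter (t ≤ g ·)).card) :
    ∑ b ∈ B, g b ≤ ∑ a ∈ A, g a := by
  -- Hall's theorem injects `B` into `A` without lowering values; for a subset `S`, the threshold at
  -- its least value gives Hall's condition.
  obtain ⟨f, hf, hfA⟩ := (Finset.all_card_le_biUnion_card_iff_exists_injective
    (fun b : B => A.filter (g b ≤ g ·))).1 (by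
      intro S
      rcases S.eq_empty_or_nonempty with rfl | hS
      · simp
      obtain ⟨b, hb, hmin⟩ := S.exists_min_image (fun b : B => g b) hS
      calc S.card = (S.map (Function.Embedding.subtype _)).card := (Finset.card_map _).symm
        _ ≤ (B.filter (g b ≤ g ·)).card := by
            refine Finset.card_le_card fun a ha => ?_
            simp only [Finset.mem_map, Function.Embedding.subtype_apply] at ha
            obtain ⟨a, ha, rfl⟩ := ha
            exact Finset.mem_filter.2 ⟨a.2, hmin a ha⟩
        _ ≤ (A.filter (g b ≤ g ·)).card := h _
        _ ≤ _ := Finset.card_le_card (Finset.subset_biUnion_of_mem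
            (fun b : B => A.filter (g b ≤ g ·)) hb))
  simp only [Finset.mem_filter] at hfA
  calc ∑ b ∈ B, g b = ∑ b : B, g b := (Finset.sum_coe_sort B g).symm
    _ ≤ ∑ b : B, g (f b) := Finset.sum_le_sum fun b _ => (hfA b).2
    _ = ∑ a ∈ Finset.univ.map ⟨f, hf⟩, g a := by simp
    _ ≤ ∑ a ∈ A, g a := by
        refine Finset.sum_le_sum_of_subset_of_nonneg ?_ fun a ha _ => hg a ha
        intro a ha
        simp only [Finset.mem_map, Finset.mem_univ, true_and, Function.Embedding.coeFn_mk] at ha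
        obtain ⟨b, rfl⟩ := ha
        exact (hfA b).1

theorem eventually_mul_exp_lt {u w : ℝ} (h : u < w) (C : ℝ) :
    ∀ᶠ s : ℝ in atTop, C * Real.exp (-(s * w)) < Real.exp (-(s * u)) := by
  have h1 : Tendsto (fun s : ℝ => Real.exp (s * (w - u))) atTop atTop :=
    Real.tendsto_exp_atTop.comp (tendsto_id.atTop_mul_const (sub_pos.2 h))
  filter_upwards [h1.eventually_gt_atTop C] with s hs
  have h2 : Real.exp (-(s * u)) = Real.exp (s * (w - u)) * Real.exp (-(s * w)) := by
    rw [← Real.exp_add]; ring_nf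
  rw [h2]
  exact mul_lt_mul_of_pos_right hs (Real.exp_pos _)

/-- The decrease of `exp (-s r)` when the share fraction `r` grows from `m / c` to
`(m + 1) / c`. -/
noncomputable def expGain (s c m : ℝ) : ℝ :=
  Real.exp (-(s * (m / c))) - Real.exp (-(s * ((m + 1) / c)))

theorem expGain_eq (s c m : ℝ) :
    expGain s c m = Real.exp (-(s * (m / c))) * (1 - Real.exp (-(s * (1 / c)))) := by
  rw [expGain, mul_sub, ← Real.exp_add]
  ring_nf

theorem one_sub_exp_nonneg {s c : ℝ} (hs : 0 ≤ s) (hc : 0 ≤ c) :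
    0 ≤ 1 - Real.exp (-(s * (1 / c))) := by
  rw [sub_nonneg, Real.exp_le_one_iff, neg_nonpos]
  positivity

theorem expGain_nonneg {s c : ℝ} (hs : 0 ≤ s) (hc : 0 ≤ c) (m : ℝ) : 0 ≤ expGain s c m := by
  rw [expGain_eq]
  exact mul_nonneg (Real.exp_pos _).le (one_sub_exp_nonneg hs hc)

theorem expGain_antitone {s c : ℝ} (hs : 0 ≤ s) (hc : 0 ≤ c) : Antitone (expGain s c) := by
  intro m p h
  rw [expGain_eq, expGain_eq]
  refine mul_le_mul_of_nonneg_right ?_ (one_sub_exp_nonneg hs hc)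
  rw [Real.exp_le_exp, neg_le_neg_iff]
  gcongr

theorem sum_expGain (s c : ℝ) (a : ℕ) :
    ∑ m ∈ Finset.range a, expGain s c m = 1 - Real.exp (-(s * (a / c))) := by
  have := Finset.sum_range_sub' (fun m : ℕ => Real.exp (-(s * (m / c)))) a
  simpa [expGain] using this

/-- A strictly smaller starting fraction wins by its leading exponential. At equal fractions the
smaller share takes the larger jump, which is why ties in the gain function are broken by `-c`. -/
theorem eventually_expGain_le {c d m p : ℝ} (hd : 0 < d)
    (h : p / d < m / c ∨ p / d = m / c ∧ d ≤ c) :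
    ∀ᶠ s in atTop, expGain s c m ≤ expGain s d p := by
  rcases h with h | ⟨h, hdc⟩
  · have h' : p / d < (p + 1) / d := div_lt_div_of_pos_right (by linarith) hd
    -- The factor 2 gives half of the leading term to the competing gain and half to the subtracted
    -- term.
    filter_upwards [eventually_mul_exp_lt h 2, eventually_mul_exp_lt h' 2] with s h1 h2
    have := Real.exp_pos (-(s * ((m + 1) / c)))
    simp only [expGain]
    linarith
  · filter_upwards [eventually_ge_atTop 0] with s hs
    rw [expGain_eq, expGain_eq, h]
    refine mul_le_mul_of_nonneg_left ?_ (Real.exp_pos _).le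
    rw [sub_le_sub_iff_left, Real.exp_le_exp, neg_le_neg_iff]
    gcongr

/-- The terms before `k` cancel. From `k` on, sortedness bounds the sum for `y` by `b` copies of its
term at `k`, which for large `s` is less than the single term of `x` at `k`. -/
theorem LexDominates.eventually_sum_exp_lt {b : ℕ} {x y : Fin b → ℝ} (hy : Monotone y)
    (h : LexDominates y x) :
    ∀ᶠ s in atTop, ∑ j, Real.exp (-(s * y j)) < ∑ j, Real.exp (-(s * x j)) := by
  obtain ⟨k, heq, hk⟩ := h
  filter_upwards [eventually_mul_exp_lt hk b, eventually_ge_atTop 0] with s hs hs0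
  have h1 (u : Fin b → ℝ) : ∑ j, Real.exp (-(s * u j)) =
      ∑ j ∈ Finset.univ.filter (· < k), Real.exp (-(s * u j)) +
        ∑ j ∈ Finset.univ.filter (¬ · < k), Real.exp (-(s * u j)) :=
    (Finset.sum_filter_add_sum_filter_not _ _ _).symm
  rw [h1 y, h1 x]
  have h2 : ∑ j ∈ Finset.univ.filter (· < k), Real.exp (-(s * y j)) =
      ∑ j ∈ Finset.univ.filter (· < k), Real.exp (-(s * x j)) :=
    Finset.sum_congr rfl fun j hj => by rw [heq j (Finset.mem_filter.1 hj).2]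
  have h3 : ∑ j ∈ Finset.univ.filter (¬ · < k), Real.exp (-(s * y j)) ≤
      b * Real.exp (-(s * y k)) := by
    refine (Finset.sum_le_card_nsmul _ _ (Real.exp (-(s * y k))) fun j hj => ?_).trans ?_
    · rw [Real.exp_le_exp, neg_le_neg_iff]
      exact mul_le_mul_of_nonneg_left (hy (not_lt.1 (Finset.mem_filter.1 hj).2)) hs0
    · rw [nsmul_eq_mul]
      refine mul_le_mul_of_nonneg_right ?_ (Real.exp_pos _).le
      exact_mod_cast (Finset.card_le_univ _).trans_eq (Fintype.card_fin b)
  have h4 : Real.exp (-(s * x k)) ≤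
      ∑ j ∈ Finset.univ.filter (¬ · < k), Real.exp (-(s * x j)) :=
    Finset.single_le_sum (f := fun j => Real.exp (-(s * x j)))
      (fun j _ => (Real.exp_pos _).le) (by simp)
  linarith

end Sums

/-! ### Optimality of the output -/

section Optimality

open Filter

variable {n : ℕ} {G : Type*} [Fintype G] {v : Fin n → Finset G → ℝ} {c : Fin n → ℝ} {M : ℝ}

theorem sum_sortedShareFractions (Y : Allocation n G) (F : ℝ → ℝ) :
    ∑ j, F (sortedShareFractions v c Y j) =
      ∑ i ∈ posAgents c, F (utility v Y i / c i) := by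
  calc ∑ j, F (sortedShareFractions v c Y j) = ∑ j, F (shareFractions v c Y j) :=
        Equiv.sum_comp (Tuple.sort (shareFractions v c Y)) fun j => F (shareFractions v c Y j)
    _ = ∑ i : posAgents c, F (utility v Y i / c i) :=
        Equiv.sum_comp ((posAgents c).orderIsoOfFin rfl).toEquiv
          fun i : posAgents c => F (utility v Y i / c i)
    _ = _ := Finset.sum_coe_sort (posAgents c) fun i => F (utility v Y i / c i)

variable [DecidableEq G]

/-- Units of utility are compared at each threshold `t`. The agents whose next unit is worth at
least `t` have tight sets with union `B`. Inside `B` all units of `X` are worth at least `t`, and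
`Y` has no more units in total; outside `B`, every unit of `Y` worth at least `t` is already present
in `X`. -/
theorem Invariant.sum_expGain_le (hv : ∀ i, IsMRF (v i)) {X Y : Allocation n G}
    (h : Invariant v c M ⟨X, ∅⟩) {a b : Fin n → ℕ} (ha : ∀ i, utility v X i = a i)
    (hb : ∀ i, utility v Y i = b i) {s : ℝ} (hs0 : 0 ≤ s)
    (hs : ∀ i k, 0 < c i → a k ≠ 0 → key c M (a i) i ≤ key c M (a k - 1) k →
      0 < c k ∧ expGain s (c i) (a i) ≤ expGain s (c k) (a k - 1)) :
    ∑ i ∈ posAgents c, ∑ m ∈ Finset.range (b i), expGain s (c i) m ≤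
      ∑ i ∈ posAgents c, ∑ m ∈ Finset.range (a i), expGain s (c i) m := by
  classical
  have hpos (i : Fin n) : i ∈ posAgents c ↔ 0 < c i := by simp [posAgents]
  rw [Finset.sum_sigma', Finset.sum_sigma']
  refine sum_le_sum_of_card_le (g := fun p : (_ : Fin n) × ℕ => expGain s (c p.1) p.2) ?_ ?_
  · intro p hp
    exact expGain_nonneg hs0 ((hpos _).1 (Finset.mem_sigma.1 hp).1).le _
  intro t
  have hcard : ∀ d : Fin n → ℕ,
      (((posAgents c).sigma fun i => Finset.range (d i)).filter
        (fun p => t ≤ expGain s (c p.1) p.2)).card =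
      ∑ i ∈ posAgents c, ((Finset.range (d i)).filter fun m : ℕ => t ≤ expGain s (c i) m).card := by
    intro d
    rw [← Finset.card_sigma]
    congr 1
    ext ⟨i, m⟩
    simp [and_assoc]
  rw [hcard, hcard]
  choose A hiA hA hAk using fun i => h.removed i (Finset.notMem_empty i)
  simp only [ha] at hAk
  set S := (posAgents c).filter fun i => t ≤ expGain s (c i) (a i) with hS
  set B := S.biUnion A with hB
  have hBk : ∀ k ∈ B, a k = 0 ∨ 0 < c k ∧ t ≤ expGain s (c k) (a k - 1) := by
    intro k hk
    obtain ⟨i, hi, hk⟩ := Finset.mem_biUnion.1 hk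
    obtain ⟨hi, hti⟩ := Finset.mem_filter.1 hi
    by_cases h0 : a k = 0
    · exact .inl h0
    · have h1 := (hAk i k hk).resolve_left (by exact_mod_cast h0)
      obtain ⟨h2, h3⟩ := hs i k ((hpos i).1 hi) h0 h1
      exact .inr ⟨h2, hti.trans h3⟩
  have hsum : ∑ k ∈ B, b k ≤ ∑ k ∈ B, a k := by
    have h1 := (Tight.biUnion hv S fun i _ => hA i).sum_utility_le hv Y
    simp only [ha, hb] at h1
    exact_mod_cast h1
  have hin : ∑ i ∈ posAgents c with i ∈ B,
        ((Finset.range (b i)).filter fun m : ℕ => t ≤ expGain s (c i) m).card ≤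
      ∑ i ∈ posAgents c with i ∈ B,
        ((Finset.range (a i)).filter fun m : ℕ => t ≤ expGain s (c i) m).card := by
    calc _ ≤ ∑ i ∈ posAgents c with i ∈ B, b i := Finset.sum_le_sum fun i _ =>
          (Finset.card_filter_le _ _).trans_eq (Finset.card_range _)
      _ ≤ ∑ i ∈ B, b i := Finset.sum_le_sum_of_subset fun i hi => (Finset.mem_filter.1 hi).2
      _ ≤ ∑ i ∈ B, a i := hsum
      -- By `hBk`, members of `B` without a positive share have utility 0 under `X`, so dropping
      -- them loses nothing.
      _ = ∑ i ∈ posAgents c with i ∈ B, a i := by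
          refine (Finset.sum_subset (fun i hi => (Finset.mem_filter.1 hi).2) ?_).symm
          intro i hi hi'
          refine (hBk i hi).resolve_right fun h => hi' ?_
          exact Finset.mem_filter.2 ⟨(hpos i).2 h.1, hi⟩
      _ = _ := by
          refine Finset.sum_congr rfl fun i hi => ?_
          rw [Finset.filter_true_of_mem, Finset.card_range]
          intro m hm
          have hm := Finset.mem_range.1 hm
          obtain ⟨h1, h2⟩ := (hBk i (Finset.mem_filter.1 hi).2).resolve_left (by omega)
          refine h2.trans (expGain_antitone hs0 h1.le ?_)
          have : (m : ℝ) + 1 ≤ a i := by exact_mod_cast hm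
          linarith
  have hout : ∑ i ∈ posAgents c with i ∉ B,
        ((Finset.range (b i)).filter fun m : ℕ => t ≤ expGain s (c i) m).card ≤
      ∑ i ∈ posAgents c with i ∉ B,
        ((Finset.range (a i)).filter fun m : ℕ => t ≤ expGain s (c i) m).card := by
    refine Finset.sum_le_sum fun i hi => Finset.card_le_card fun m hm => ?_
    obtain ⟨hip, hiB⟩ := Finset.mem_filter.1 hi
    obtain ⟨-, hm⟩ := Finset.mem_filter.1 hm
    refine Finset.mem_filter.2 ⟨Finset.mem_range.2 ?_, hm⟩
    by_contra! hle
    -- If `X` lacked unit `m`, its next unit `a i` would be worth at least as much, which would put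
    -- `i` into `S` and hence into `B`.
    refine hiB (Finset.mem_biUnion.2 ⟨i, Finset.mem_filter.2 ⟨hip, hm.trans ?_⟩, hiA i⟩)
    exact expGain_antitone hs0 ((hpos i).1 hip).le (by exact_mod_cast hle)
  rw [← Finset.sum_filter_add_sum_filter_not (posAgents c) (· ∈ B),
    ← Finset.sum_filter_add_sum_filter_not (posAgents c) (· ∈ B)
      (fun i => ((Finset.range (a i)).filter fun m : ℕ => t ≤ expGain s (c i) m).card)]
  exact add_le_add hin hout

theorem Invariant.not_lexDominates (hv : ∀ i, IsMRF (v i))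
    (hM : ∀ i, 0 < c i → ∀ S : Finset G, v i S / c i < M) {X : Allocation n G}
    (h : Invariant v c M ⟨X, ∅⟩) (Y : Allocation n G) :
    ¬ LexDominates (sortedShareFractions v c Y) (sortedShareFractions v c X) := by
  intro hlex
  choose a ha using fun i => (hv i).exists_nat (bundle X (some i))
  choose b hb using fun i => (hv i).exists_nat (bundle Y (some i))
  have ha' : ∀ i, utility v X i = a i := ha
  have hb' : ∀ i, utility v Y i = b i := hb
  have hev : ∀ᶠ s in atTop, ∀ i k, 0 < c i → a k ≠ 0 →
      key c M (a i) i ≤ key c M (a k - 1) k →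
      0 < c k ∧ expGain s (c i) (a i) ≤ expGain s (c k) (a k - 1) := by
    simp only [eventually_all]
    intro i k hi _ hkey
    obtain ⟨hk, hlt⟩ := of_key_le_key hi (ha i ▸ hM i hi _) hkey
    filter_upwards [eventually_expGain_le hk hlt] with s hs using ⟨hk, hs⟩
  -- A single large `s` serves the finitely many pairs of agents and the comparison of the two sums
  -- at once.
  obtain ⟨s, hs0, hs, hlt⟩ := ((eventually_ge_atTop 0).and (hev.and
    (hlex.eventually_sum_exp_lt (Tuple.monotone_sort _)))).exists
  have hle := h.sum_expGain_le hv ha' hb' hs0 hs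
  change ∑ j, Real.exp (-(s * sortedShareFractions v c Y j)) < _ at hlt
  rw [sum_sortedShareFractions Y fun r => Real.exp (-(s * r)),
    sum_sortedShareFractions X fun r => Real.exp (-(s * r))] at hlt
  simp only [sum_expGain, Finset.sum_sub_distrib, ha', hb'] at hle hlt
  linarith

end Optimality

end FairShare

/-- The first two parts say that the output is well defined: there is no infinite execution of the
algorithm, and a nonfinal reachable state always admits a further iteration. -/
theorem mainTheorem7 {n : ℕ} {G : Type*} [Fintype G] [DecidableEq G]
    (v : Fin n → Finset G → ℝ) (hv : ∀ i, FairShare.IsMRF (v i))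
    (c : Fin n → ℝ) (hc : ∀ i, 0 ≤ c i)
    (M : ℝ) (hM0 : 0 < M) (hM : ∀ i, 0 < c i → ∀ S : Finset G, v i S / c i < M) :
    (¬ ∃ s : ℕ → FairShare.State n G, s 0 = FairShare.initState n G ∧
        ∀ t, FairShare.Step v (FairShare.fairShareGain c M) (s t) (s (t + 1))) ∧
    (∀ s : FairShare.State n G,
        Relation.ReflTransGen (FairShare.Step v (FairShare.fairShareGain c M))
          (FairShare.initState n G) s →
        s.playing ≠ ∅ → ∃ s', FairShare.Step v (FairShare.fairShareGain c M) s s') ∧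
    (∀ X : FairShare.Allocation n G, FairShare.IsOutput v (FairShare.fairShareGain c M) X →
      ∀ Y : FairShare.Allocation n G,
        ¬ FairShare.LexDominates (FairShare.sortedShareFractions v c Y)
            (FairShare.sortedShareFractions v c X)) := by
  exact ⟨FairShare.not_exists_infinite_run hv, fun s _ hs => FairShare.exists_step s hs,
    fun X hX => (FairShare.Invariant.of_reachable hv hX).not_lexDominates hv hM⟩
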